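/- Let $G=(V,E,r,s)$ be a directed graph: $V$ (vertices) and $E$ (edges) are arbitrary sets and $r,s:E\to V$ are arbitrary maps (range and source). The *graph inverse semigroup* $I(G)$ is the semigroup with zero generated by $V\cup E\cup\{e^*:e\in E\}$ subject to the relations, for all $u,v\in V$ and $e,f\in E$: $uv=\delta_{u,v}u$; $s(e)e=e\,r(e)=e$; $r(e)e^*=e^*s(e)=e^*$; $f^*e=\delta_{f,e}r(e)$. A *cycle* of $G$ is a sequence of edges $c=e_1\cdots e_n$ with $n\ge 1$, $r(e_i)=s(e_{i+1})$ for $1\le i<n$, $r(e_n)=s(e_1)$, and $s(e_1),\dots,s(e_n)$ pairwise distinct; put $s(c)=s(e_1)$. A *congruence pair* of $G$ is a pair $(W,f)$, where $W$ is a set of vertices $v$ with $|s^{-1}(v)|=1$ and $f$ is a function from the set $C(W)$ of all cycles $e_1\cdots e_n$ with all $s(e_i)\in W$ to $\mathbb Z^+\cup\{\infty\}$ that is invariant under cyclic permutations of cycles. A set $H\subseteq V$ is *hereditary* if $s(e)\in H$ implies $r(e)\in H$ for all $e\in E$; then $G\setminus H$ denotes the graph with vertex set $V\setminus H$ and edge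 set $\{e\in E: r(e)\notin H\}$, with the restricted maps $r$ and $s$. A *congruence triple* of $G$ is a triple $(H,W,f)$, where $H\subseteq V$ is hereditary and $(W,f)$ is a congruence pair of $G\setminus H$. For a congruence $\rho$ on $I(G)$ let $T(\rho)=(H,W,f)$, where $H=\{v\in V: v\,\rho\,0\}$ (a hereditary set); $W$ is the set of all $v\in V\setminus H$ such that $G\setminus H$ has at least one edge with source $v$ and $ee^*\,\rho\,v$ for every edge $e$ of $G\setminus H$ with source $v$; and, for every cycle $c$ of $G\setminus H$ in $C(W)$, $f(c)$ is the smallest positive integer $m$ with $c^m\,\rho\,s(c)$, or $\infty$ if there is no such $m$. This is a congruence triple of $G$. For a congruence triple $(H,W,f)$ of $G$ let $\wp(H,W,f)$ be the congruence on $I(G)$ generated by all pairs $(v,0)$ with $v\in H$, all pairs $(ee^*,w)$ with $w\in W$ and $e$ an edge of $G\setminus H$ with $s(e)=w$, and all pairs $(c^{f(c)},s(c))$ with $c\in C(W)$ and $f(c)<\infty$. **Theorem 1.2.** For every directed graph $G$, the map $T$ from the set of all congruences on $I(G)$ to the set of all congruence triples of $G$ and the map $\wp$ from the set of all congruence triples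 of $G$ to the set of all congruences on $I(G)$ are mutually inverse. In particular, $T$ is a bijection between the congruences on $I(G)$ and the congruence triples of $G$. -/

import Mathlib

universe u v

/-- A directed graph `(V, E, r, s)`: loops and multiple edges are allowed, and there are no
finiteness conditions. -/
structure DirectedGraph where
  /-- vertices -/
  V : Type u
  /-- edges -/
  E : Type v
  /-- source of an edge -/
  s : E → V
  /-- range of an edge -/
  r : E → V

namespace DirectedGraph

variable (G : DirectedGraph.{u, v})

/-! ### The graph inverse semigroup, by generators and relations -/

/-- The generators of the graph inverse semigroup: `V`, `E` and `E* = {e* : e ∈ E}`. -/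
inductive Gen : Type (max u v)
  | vert (v : G.V)
  | edge (e : G.E)
  | ghost (e : G.E)

/-- The free semigroup with zero on the generators. -/
abbrev FreeZero : Type (max u v) := WithZero (FreeSemigroup (Gen G))

/-- A generator as an element of the free semigroup with zero. -/
def gen (x : Gen G) : G.FreeZero := (FreeSemigroup.of x : FreeSemigroup (Gen G))

/-- The defining relations (GI1), (GI2), (GI3), (CK1). -/
inductive Rel : G.FreeZero → G.FreeZero → Prop
  | gi1_same (u : G.V) : Rel (G.gen (.vert u) * G.gen (.vert u)) (G.gen (.vert u))
  | gi1_ne (u v : G.V) (h : u ≠ v) : Rel (G.gen (.vert u) * G.gen (.vert v)) 0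
  | gi2_source (e : G.E) : Rel (G.gen (.vert (G.s e)) * G.gen (.edge e)) (G.gen (.edge e))
  | gi2_range (e : G.E) : Rel (G.gen (.edge e) * G.gen (.vert (G.r e))) (G.gen (.edge e))
  | gi3_range (e : G.E) : Rel (G.gen (.vert (G.r e)) * G.gen (.ghost e)) (G.gen (.ghost e))
  | gi3_source (e : G.E) : Rel (G.gen (.ghost e) * G.gen (.vert (G.s e))) (G.gen (.ghost e))
  | ck1_same (e : G.E) : Rel (G.gen (.ghost e) * G.gen (.edge e)) (G.gen (.vert (G.r e)))
  | ck1_ne (f e : G.E) (h : f ≠ e) : Rel (G.gen (.ghost f) * G.gen (.edge e)) 0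

/-- The graph inverse semigroup of `G`: the semigroup with zero generated by
`V ∪ E ∪ E*` subject to the relations `Rel`. -/
def InvSemigroup : Type (max u v) := (conGen G.Rel).Quotient

/-- The quotient map from the free semigroup with zero. -/
def toInv (x : G.FreeZero) : G.InvSemigroup := (x : (conGen G.Rel).Quotient)

instance : SemigroupWithZero G.InvSemigroup where
  toSemigroup := inferInstanceAs (Semigroup (conGen G.Rel).Quotient)
  zero := G.toInv 0
  zero_mul a := by
    induction a using Quotient.inductionOn with
    | _ x => exact congrArg G.toInv (zero_mul x)
  mul_zero a := by
    induction a using Quotient.inductionOn with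
    | _ x => exact congrArg G.toInv (mul_zero x)

/-- The vertex `v` as an element of the semigroup. -/
def vert (v : G.V) : G.InvSemigroup := G.toInv (G.gen (.vert v))

/-- The edge `e` as an element of the semigroup. -/
def edge (e : G.E) : G.InvSemigroup := G.toInv (G.gen (.edge e))

/-- The ghost edge `e*` as an element of the semigroup. -/
def ghost (e : G.E) : G.InvSemigroup := G.toInv (G.gen (.ghost e))

/-! ### Paths and cycles -/

/-- `G.IsPath u l v`: the list of edges `l` is a path with source `u` and range `v`
(the empty list is the path of length `0` at `u = v`). -/
def IsPath : G.V → List G.E → G.V → Prop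
  | u, [], v => u = v
  | u, e :: l, v => G.s e = u ∧ IsPath (G.r e) l v

/-- The element `v e₁ ⋯ eₙ` of the semigroup; for a path `e₁ ⋯ eₙ` with source `v` this is the
path itself as an element of the semigroup. -/
def pathElt (v : G.V) (l : List G.E) : G.InvSemigroup :=
  l.foldl (fun x e => x * G.edge e) (G.vert v)

/-- The `m`-th power of a closed path `l` based at `v`, as an element of the semigroup: the
concatenation of `m` copies of `l` (for `m = 0` it is `v`). -/
def closedPow (v : G.V) (l : List G.E) (m : ℕ) : G.InvSemigroup :=
  G.pathElt v (List.replicate m l).flatten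

/-- A cycle: a path `e₁ ⋯ eₙ`, `n ≥ 1`, with equal source and range (`base`), whose edges have
pairwise distinct sources. -/
structure Cycle where
  /-- the common source and range -/
  base : G.V
  /-- the edges `e₁, …, eₙ` -/
  edges : List G.E
  ne_nil : edges ≠ []
  isPath : G.IsPath base edges base
  nodup : (edges.map G.s).Nodup

/-- The set of all cycles whose vertices lie in `W`. -/
def cyclesIn (W : Set G.V) : Set G.Cycle := {c | ∀ e ∈ c.edges, G.s e ∈ W}

/-- The set of all vertices of index one. -/
def indexOne : Set G.V := {v | {e : G.E | G.s e = v}.encard = 1}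

/-! ### Hereditary sets, congruence pairs and congruence triples -/

/-- Hereditary sets of vertices. -/
def IsHereditary (H : Set G.V) : Prop := ∀ e : G.E, G.s e ∈ H → G.r e ∈ H

/-- The graph `G \ H`, for a hereditary set `H`: its vertices are those outside `H`, its edges are
those with range outside `H`. -/
abbrev delete (H : Set G.V) (hH : G.IsHereditary H) : DirectedGraph.{u, v} where
  V := {v : G.V // v ∉ H}
  E := {e : G.E // G.r e ∉ H}
  s e := ⟨G.s e.1, fun h => e.2 (hH e.1 h)⟩
  r e := ⟨G.r e.1, e.2⟩

/-- A congruence pair `(W, f)` of `G`: a set `W` of vertices of index one and a cycle function `f`,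
that is, a function from the cycles in `W` to `ℤ⁺ ∪ {∞}` that is invariant under cyclic
permutations. -/
structure CongruencePair where
  W : Set G.V
  subset_indexOne : W ⊆ G.indexOne
  f : G.cyclesIn W → WithTop ℕ+
  f_rotated : ∀ c d : G.cyclesIn W, c.1.edges ~r d.1.edges → f c = f d

/-- A congruence triple `(H, W, f)` of `G`: a hereditary set `H` and a congruence pair `(W, f)`
of `G \ H`. -/
structure CongruenceTriple where
  H : Set G.V
  hereditary : G.IsHereditary H
  pair : (G.delete H hereditary).CongruencePair

/-- The power `c ^ m` of a cycle `c` of `G \ H`, in the inverse semigroup of `G`. -/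
def deletePow {G : DirectedGraph.{u, v}} {H : Set G.V} {hH : G.IsHereditary H}
    (c : (G.delete H hH).Cycle) (m : ℕ) : G.InvSemigroup :=
  G.closedPow c.base.1 (c.edges.map Subtype.val) m

/-! ### From congruence triples to congruences -/

variable {G}

/-- The pairs that generate the congruence of a congruence triple `(H, W, f)`. -/
inductive TripleRel (t : G.CongruenceTriple) : G.InvSemigroup → G.InvSemigroup → Prop
  | zero (v : G.V) (hv : v ∈ t.H) : TripleRel t (G.vert v) 0
  | edge (e : (G.delete t.H t.hereditary).E)
      (he : (G.delete t.H t.hereditary).s e ∈ t.pair.W) :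
      TripleRel t (G.edge e.1 * G.ghost e.1) (G.vert (G.s e.1))
  | cycle (c : (G.delete t.H t.hereditary).cyclesIn t.pair.W) (m : ℕ+)
      (hm : t.pair.f c = (m : WithTop ℕ+)) :
      TripleRel t (deletePow c.1 m) (G.vert c.1.base.1)

/-- The map `℘`: the congruence generated by the pairs `(v, 0)` for `v ∈ H`, `(e e*, s(e))` for
edges `e` of `G \ H` with `s(e) ∈ W`, and `(c ^ f(c), s(c))` for cycles `c` in `W` with
`f(c) < ∞`. -/
def tripleCon (t : G.CongruenceTriple) : Con G.InvSemigroup := conGen (TripleRel t)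

/-! ### From congruences to congruence triples -/

/-- `H = 0ρ ∩ V`. -/
def zeroSet (ρ : Con G.InvSemigroup) : Set G.V := {v | ρ (G.vert v) 0}

theorem vert_mul_edge (e : G.E) : G.vert (G.s e) * G.edge e = G.edge e :=
  (Con.eq _).2 (ConGen.Rel.of _ _ (Rel.gi2_source e))

theorem edge_mul_vert (e : G.E) : G.edge e * G.vert (G.r e) = G.edge e :=
  (Con.eq _).2 (ConGen.Rel.of _ _ (Rel.gi2_range e))

theorem ghost_mul_edge (e : G.E) : G.ghost e * G.edge e = G.vert (G.r e) :=
  (Con.eq _).2 (ConGen.Rel.of _ _ (Rel.ck1_same e))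

theorem ghost_mul_edge_ne {f e : G.E} (h : f ≠ e) : G.ghost f * G.edge e = 0 :=
  (Con.eq _).2 (ConGen.Rel.of _ _ (Rel.ck1_ne f e h))

theorem isHereditary_zeroSet (ρ : Con G.InvSemigroup) : G.IsHereditary (zeroSet ρ) := by
  intro e he
  have h := ρ.mul (ρ.mul (ρ.refl (G.ghost e)) he) (ρ.refl (G.edge e))
  rw [mul_assoc, vert_mul_edge, ghost_mul_edge, mul_zero, zero_mul] at h
  exact h

/-- The set of the vertices `v` of `G \ H` that emit an edge in `G \ H` and satisfy `e e* ρ v` for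
all edges `e` of `G \ H` with source `v`. -/
def conW (ρ : Con G.InvSemigroup) : Set (G.delete (zeroSet ρ) (isHereditary_zeroSet ρ)).V :=
  {v | (∃ e, (G.delete (zeroSet ρ) (isHereditary_zeroSet ρ)).s e = v) ∧
    ∀ e, (G.delete (zeroSet ρ) (isHereditary_zeroSet ρ)).s e = v →
      ρ (G.edge e.1 * G.ghost e.1) (G.vert v.1)}

theorem conW_subset_indexOne (ρ : Con G.InvSemigroup) :
    conW ρ ⊆ (G.delete (zeroSet ρ) (isHereditary_zeroSet ρ)).indexOne := by
  rintro v ⟨⟨e, rfl⟩, hv⟩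
  refine Set.encard_eq_one.2 ⟨e, Set.eq_singleton_iff_unique_mem.2 ⟨rfl, ?_⟩⟩
  intro e' he'
  by_contra hne
  have hne' : e.1 ≠ e'.1 := fun h => hne (Subtype.ext h.symm)
  have h := ρ.mul (ρ.mul (ρ.refl (G.ghost e'.1)) (hv e rfl)) (ρ.refl (G.edge e'.1))
  have hs : G.s e.1 = G.s e'.1 := (congrArg Subtype.val he').symm
  simp only at h
  rw [hs, mul_assoc (G.ghost e'.1) (G.vert _), vert_mul_edge, ghost_mul_edge, mul_assoc,
    mul_assoc, ghost_mul_edge_ne hne', mul_zero, mul_zero] at h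
  exact e'.2 (ρ.symm h)

open Classical in
/-- The smallest positive integer that satisfies `P`, and `∞` if there is none. -/
noncomputable def leastPos (P : ℕ+ → Prop) : WithTop ℕ+ :=
  if h : ∃ m : ℕ+, P m then ((PNat.find h : ℕ+) : WithTop ℕ+) else ⊤

/-- The smallest positive integer `m` with `c ^ m ρ s(c)`, and `∞` if there is none. -/
noncomputable def conF (ρ : Con G.InvSemigroup)
    (c : (G.delete (zeroSet ρ) (isHereditary_zeroSet ρ)).Cycle) : WithTop ℕ+ :=
  leastPos fun m : ℕ+ => ρ (deletePow c m) (G.vert c.base.1)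

theorem mul_foldl_edge (x y : G.InvSemigroup) (l : List G.E) :
    x * l.foldl (fun x e => x * G.edge e) y = l.foldl (fun x e => x * G.edge e) (x * y) := by
  induction l generalizing y with
  | nil => rfl
  | cons e l ih => rw [List.foldl_cons, List.foldl_cons, ih, mul_assoc]

theorem flatten_replicate_cons (e : G.E) (l : List G.E) (m : ℕ) :
    (List.replicate m (e :: l)).flatten ++ [e] = e :: (List.replicate m (l ++ [e])).flatten := by
  induction m with
  | zero => rfl
  | succ m ih =>
    rw [List.replicate_succ, List.flatten_cons, List.append_assoc, ih, List.replicate_succ,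
      List.flatten_cons]
    simp

theorem isPath_append_singleton {l : List G.E} {u : G.V} {e : G.E} (h : G.IsPath u l (G.s e)) :
    G.IsPath u (l ++ [e]) (G.r e) := by
  induction l generalizing u with
  | nil => exact ⟨h.symm, rfl⟩
  | cons a l ih => exact ⟨h.1, ih h.2⟩

theorem closedPow_rotate_one (ρ : Con G.InvSemigroup) (e : G.E) (l : List G.E) (m : ℕ)
    (h : ρ (G.closedPow (G.s e) (e :: l) m) (G.vert (G.s e))) :
    ρ (G.closedPow (G.r e) (l ++ [e]) m) (G.vert (G.r e)) := by
  have key : G.ghost e * G.closedPow (G.s e) (e :: l) m * G.edge e =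
      G.closedPow (G.r e) (l ++ [e]) m := by
    have h1 : G.closedPow (G.s e) (e :: l) m * G.edge e =
        G.pathElt (G.s e) ((List.replicate m (e :: l)).flatten ++ [e]) := by
      simp [closedPow, pathElt]
    rw [mul_assoc, h1, flatten_replicate_cons, pathElt, List.foldl_cons, vert_mul_edge,
      mul_foldl_edge, ghost_mul_edge]
    rfl
  have h2 := ρ.mul (ρ.mul (ρ.refl (G.ghost e)) h) (ρ.refl (G.edge e))
  rw [key, mul_assoc, vert_mul_edge, ghost_mul_edge] at h2
  exact h2

theorem closedPow_rotate (ρ : Con G.InvSemigroup) (m n : ℕ) (l : List G.E) (v : G.V)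
    (hl : l ≠ []) (hp : G.IsPath v l v) (h : ρ (G.closedPow v l m) (G.vert v)) :
    ∃ w, G.IsPath w (l.rotate n) w ∧ ρ (G.closedPow w (l.rotate n) m) (G.vert w) := by
  induction n generalizing l v with
  | zero => exact ⟨v, by simpa using ⟨hp, h⟩⟩
  | succ n ih =>
    cases l with
    | nil => exact absurd rfl hl
    | cons e l =>
      obtain ⟨rfl, hp⟩ := hp
      rw [List.rotate_cons_succ]
      exact ih _ _ (by simp) (isPath_append_singleton hp) (closedPow_rotate_one ρ e l m h)

theorem isPath_map_val {H : Set G.V} {hH : G.IsHereditary H}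
    {l : List (G.delete H hH).E} {u w : (G.delete H hH).V} (h : (G.delete H hH).IsPath u l w) :
    G.IsPath u.1 (l.map Subtype.val) w.1 := by
  induction l generalizing u with
  | nil => exact congrArg Subtype.val h
  | cons e l ih => exact ⟨congrArg Subtype.val h.1, ih h.2⟩

theorem deletePow_rotated (ρ : Con G.InvSemigroup) {H : Set G.V} {hH : G.IsHereditary H}
    (c d : (G.delete H hH).Cycle) (hcd : c.edges ~r d.edges) (m : ℕ)
    (h : ρ (deletePow c m) (G.vert c.base.1)) : ρ (deletePow d m) (G.vert d.base.1) := by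
  obtain ⟨n, hn⟩ := hcd
  obtain ⟨w, hw, hρ⟩ := closedPow_rotate ρ m n (c.edges.map Subtype.val) c.base.1
    (mt List.map_eq_nil_iff.1 c.ne_nil) (isPath_map_val c.isPath) h
  rw [← List.map_rotate, hn] at hw hρ
  have hd := isPath_map_val d.isPath
  have hwd : w = d.base.1 := by
    have hne : d.edges.map Subtype.val ≠ [] := mt List.map_eq_nil_iff.1 d.ne_nil
    revert hw hd hne
    generalize d.edges.map Subtype.val = l
    intro hw hd hne
    cases l with
    | nil => exact absurd rfl hne
    | cons e l => exact hw.1.symm.trans hd.1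
  subst hwd
  exact hρ

theorem conF_rotated (ρ : Con G.InvSemigroup)
    (c d : (G.delete (zeroSet ρ) (isHereditary_zeroSet ρ)).Cycle) (hcd : c.edges ~r d.edges) :
    conF ρ c = conF ρ d :=
  congrArg leastPos <| funext fun m =>
    propext ⟨deletePow_rotated ρ c d hcd m, deletePow_rotated ρ d c hcd.symm m⟩

/-- The map `T`: the congruence triple `(H, W, f)` of a congruence `ρ`. -/
noncomputable def conTriple (ρ : Con G.InvSemigroup) : G.CongruenceTriple where
  H := zeroSet ρ
  hereditary := isHereditary_zeroSet ρ
  pair :=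
    { W := conW ρ
      subset_indexOne := conW_subset_indexOne ρ
      f := fun c => conF ρ c.1
      f_rotated := fun c d h => conF_rotated ρ c.1 d.1 h }

end DirectedGraph

/-! Every element of the semigroup is zero or of the form `p q*`, for paths `p`, `q` with a common
range (`isNormal`), and this makes both composites computable.

Let σ be the congruence generated by the triple of ρ. Its generators lie in ρ, so σ ≤ ρ. Conversely,
`p*(p q*)q` is the common range of `p` and `q`, so the zero class of a congruence is determined by
its vertices. If nonzero classes contain `p q* ρ p' q'*`, with `w` the range of `p`, then
multiplication by `p*` and `q` gives `w ρ (p*p')(q'*q)`. Hence the sources agree and one of `p`,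
`p'` is a prefix of the other, as is one of `q`, `q'`. What remains is a relation `w ρ z y` or `w ρ
z y*`, and cancelling common first edges in the second leaves a closed path related to its base.
Each edge of such a path satisfies `e e* ρ s(e)`, so the path runs through `W`, where the outgoing
edge is unique. It is therefore a power `c ^ m` of a cycle, and division with remainder shows that
`f(c)` divides `m` (`tripleCon_of_closed`, `tripleCon_of_isPrefix`).

For the other composite one must show that the generated congruence identifies no more than it
should. Models do this: the semigroup acts by partial injections on vertices paired with (word,
element of an abelian group), where edges leaving `W` only translate the group component and all
others also prepend themselves to the word (`twist`). Trivial translations recover `H` and `W`.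
Translation by 1 in ℤ/f(c) along a single edge of `c` recovers `f(c)`
(`dvd_of_tripleCon_deletePow`). -/

namespace DirectedGraph

variable {G : DirectedGraph.{u, v}}

/-! ### Calculating in the graph inverse semigroup -/

theorem vert_mul_self (u : G.V) : G.vert u * G.vert u = G.vert u :=
  (Con.eq _).2 (ConGen.Rel.of _ _ (Rel.gi1_same u))

theorem vert_mul_vert_ne {u w : G.V} (h : u ≠ w) : G.vert u * G.vert w = 0 :=
  (Con.eq _).2 (ConGen.Rel.of _ _ (Rel.gi1_ne u w h))

theorem vert_mul_ghost (e : G.E) : G.vert (G.r e) * G.ghost e = G.ghost e :=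
  (Con.eq _).2 (ConGen.Rel.of _ _ (Rel.gi3_range e))

theorem ghost_mul_vert (e : G.E) : G.ghost e * G.vert (G.s e) = G.ghost e :=
  (Con.eq _).2 (ConGen.Rel.of _ _ (Rel.gi3_source e))

@[simp] theorem pathElt_nil (u : G.V) : G.pathElt u [] = G.vert u := rfl

theorem pathElt_cons (e : G.E) (l : List G.E) :
    G.pathElt (G.s e) (e :: l) = G.edge e * G.pathElt (G.r e) l := by
  rw [pathElt, pathElt, List.foldl_cons, mul_foldl_edge, vert_mul_edge, edge_mul_vert]

/-- The inverse `eₙ* ⋯ e₁* v` of the path `e₁ ⋯ eₙ` with source `v`. -/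
def ghostElt : G.V → List G.E → G.InvSemigroup
  | v, [] => G.vert v
  | _, e :: l => ghostElt (G.r e) l * G.ghost e

@[simp] theorem ghostElt_nil (u : G.V) : ghostElt u [] = G.vert u := rfl

theorem ghostElt_cons (u : G.V) (e : G.E) (l : List G.E) :
    ghostElt u (e :: l) = ghostElt (G.r e) l * G.ghost e := rfl

theorem isPath_append {l m : List G.E} {u w : G.V} :
    G.IsPath u (l ++ m) w ↔ ∃ x, G.IsPath u l x ∧ G.IsPath x m w := by
  induction l generalizing u with
  | nil => exact ⟨fun h => ⟨u, rfl, h⟩, by rintro ⟨x, rfl, h⟩; exact h⟩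
  | cons e l ih =>
    refine ⟨fun h => ?_, ?_⟩
    · obtain ⟨x, hx, hm⟩ := ih.1 h.2
      exact ⟨x, ⟨h.1, hx⟩, hm⟩
    · rintro ⟨x, hx, hm⟩
      exact ⟨hx.1, ih.2 ⟨x, hx.2, hm⟩⟩

theorem IsPath.append {l m : List G.E} {u x w : G.V} (h : G.IsPath u l x)
    (h' : G.IsPath x m w) : G.IsPath u (l ++ m) w := isPath_append.2 ⟨x, h, h'⟩

theorem IsPath.range_unique {l : List G.E} {u x w : G.V} (h : G.IsPath u l x)
    (h' : G.IsPath u l w) : x = w := by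
  induction l generalizing u with
  | nil => exact Eq.trans (Eq.symm h) h'
  | cons e l ih => exact ih h.2 h'.2

theorem IsPath.of_append {l m : List G.E} {u x w : G.V} (h : G.IsPath u (l ++ m) w)
    (hl : G.IsPath u l x) : G.IsPath x m w := by
  obtain ⟨y, hy, hm⟩ := isPath_append.1 h
  rwa [hl.range_unique hy]

theorem vert_mul_pathElt (u : G.V) (l : List G.E) :
    G.vert u * G.pathElt u l = G.pathElt u l := by
  rw [pathElt, mul_foldl_edge, vert_mul_self]

theorem pathElt_mul_vert {u w : G.V} {l : List G.E} (h : G.IsPath u l w) :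
    G.pathElt u l * G.vert w = G.pathElt u l := by
  induction l generalizing u with
  | nil => obtain rfl : u = w := h; exact vert_mul_self u
  | cons e l ih => obtain ⟨rfl, h⟩ := h; rw [pathElt_cons, mul_assoc, ih h]

theorem pathElt_append {u w : G.V} {l : List G.E} (h : G.IsPath u l w) (m : List G.E) :
    G.pathElt u (l ++ m) = G.pathElt u l * G.pathElt w m := by
  induction l generalizing u with
  | nil => obtain rfl : u = w := h; exact (vert_mul_pathElt u m).symm
  | cons e l ih =>
    obtain ⟨rfl, h⟩ := h
    rw [List.cons_append, pathElt_cons, pathElt_cons, mul_assoc, ih h]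

theorem vert_mul_ghostElt {u w : G.V} {l : List G.E} (h : G.IsPath u l w) :
    G.vert w * ghostElt u l = ghostElt u l := by
  induction l generalizing u with
  | nil => obtain rfl : u = w := h; exact vert_mul_self u
  | cons e l ih => rw [ghostElt_cons, ← mul_assoc, ih h.2]

theorem ghostElt_mul_vert {u w : G.V} {l : List G.E} (h : G.IsPath u l w) :
    ghostElt u l * G.vert u = ghostElt u l := by
  cases l with
  | nil => exact vert_mul_self u
  | cons e l => obtain ⟨rfl, h⟩ := h; rw [ghostElt_cons, mul_assoc, ghost_mul_vert]

theorem ghostElt_append {u w x : G.V} {l m : List G.E} (h : G.IsPath u l w)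
    (hm : G.IsPath w m x) : ghostElt u (l ++ m) = ghostElt w m * ghostElt u l := by
  induction l generalizing u with
  | nil => obtain rfl : u = w := h; exact (ghostElt_mul_vert hm).symm
  | cons e l ih =>
    rw [List.cons_append, ghostElt_cons, ghostElt_cons, ih h.2, mul_assoc]

theorem ghostElt_mul_pathElt {u w : G.V} {l : List G.E} (h : G.IsPath u l w) :
    ghostElt u l * G.pathElt u l = G.vert w := by
  induction l generalizing u with
  | nil => obtain rfl : u = w := h; exact vert_mul_self u
  | cons e l ih =>
    obtain ⟨rfl, h⟩ := h
    rw [ghostElt_cons, pathElt_cons, mul_assoc, ← mul_assoc (G.ghost e), ghost_mul_edge,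
      vert_mul_pathElt, ih h]

theorem ghostElt_mul_pathElt_append {u w : G.V} {l : List G.E} (h : G.IsPath u l w)
    (m : List G.E) : ghostElt u l * G.pathElt u (l ++ m) = G.pathElt w m := by
  rw [pathElt_append h, ← mul_assoc, ghostElt_mul_pathElt h, vert_mul_pathElt]

theorem ghostElt_append_mul_pathElt {u w x : G.V} {l m : List G.E} (h : G.IsPath u l w)
    (hm : G.IsPath w m x) : ghostElt u (l ++ m) * G.pathElt u l = ghostElt w m := by
  rw [ghostElt_append h hm, mul_assoc, ghostElt_mul_pathElt h, ghostElt_mul_vert hm]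

theorem ghostElt_mul_pathElt_source_ne {u u' w : G.V} {l : List G.E} (h : G.IsPath u l w)
    (hne : u ≠ u') (l' : List G.E) : ghostElt u l * G.pathElt u' l' = 0 := by
  rw [← ghostElt_mul_vert h, ← vert_mul_pathElt u', mul_assoc, ← mul_assoc (G.vert u),
    vert_mul_vert_ne hne, zero_mul, mul_zero]

/-- Compare edge by edge: equal first edges cancel through `e*e = r(e)`, and distinct ones make the
product zero. -/
theorem prefix_or_prefix_or_ghostElt_mul_eq_zero {u w w' : G.V} {l l' : List G.E}
    (h : G.IsPath u l w) (h' : G.IsPath u l' w') :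
    l <+: l' ∨ l' <+: l ∨ ghostElt u l * G.pathElt u l' = 0 := by
  induction l generalizing u l' with
  | nil => exact Or.inl (List.nil_prefix)
  | cons e l ih =>
    cases l' with
    | nil => exact Or.inr (Or.inl List.nil_prefix)
    | cons e' l' =>
      obtain ⟨rfl, h⟩ := h
      obtain ⟨hs, h'⟩ := h'
      by_cases hne : e = e'
      · subst hne
        rcases ih h h' with h1 | h1 | h1
        · exact Or.inl ((List.prefix_cons_inj e).2 h1)
        · exact Or.inr (Or.inl ((List.prefix_cons_inj e).2 h1))
        · refine Or.inr (Or.inr ?_)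
          rw [ghostElt_cons, pathElt_cons, mul_assoc, ← mul_assoc (G.ghost e), ghost_mul_edge,
            vert_mul_pathElt, h1]
      · refine Or.inr (Or.inr ?_)
        rw [← hs, ghostElt_cons, pathElt_cons, mul_assoc, ← mul_assoc (G.ghost e),
          ghost_mul_edge_ne hne, zero_mul, mul_zero]

/-- The elements `p q*`, for paths `p` and `q` with the same range, together with zero. -/
def IsNormal (a : G.InvSemigroup) : Prop :=
  a = 0 ∨ ∃ u x w p q, G.IsPath u p w ∧ G.IsPath x q w ∧ a = G.pathElt u p * ghostElt x q

/-- The case with content is `e* p q*`: it removes a leading `e` from `p`, vanishes if `p` starts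
with another edge, and lengthens `q` by `e` when `p` is a vertex equal to `s(e)`. -/
theorem isNormal_gen_mul (g : Gen G) {a : G.InvSemigroup} (ha : IsNormal a) :
    IsNormal (G.toInv (G.gen g) * a) := by
  obtain rfl | ⟨u, x, w, p, q, hp, hq, rfl⟩ := ha
  · exact Or.inl (mul_zero _)
  cases g with
  | vert y =>
    change IsNormal (G.vert y * _)
    by_cases h : y = u
    · subst h
      exact Or.inr ⟨y, x, w, p, q, hp, hq, by rw [← mul_assoc, vert_mul_pathElt]⟩
    · refine Or.inl ?_
      rw [← vert_mul_pathElt u, ← mul_assoc, ← mul_assoc, vert_mul_vert_ne h, zero_mul, zero_mul]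
  | edge e =>
    change IsNormal (G.edge e * _)
    by_cases h : G.r e = u
    · subst h
      exact Or.inr ⟨G.s e, x, w, e :: p, q, ⟨rfl, hp⟩, hq, by rw [pathElt_cons, mul_assoc]⟩
    · refine Or.inl ?_
      rw [← vert_mul_pathElt u, ← edge_mul_vert, mul_assoc, ← mul_assoc (G.vert _),
        ← mul_assoc (G.vert _), vert_mul_vert_ne h, zero_mul, zero_mul, mul_zero]
  | ghost e =>
    change IsNormal (G.ghost e * _)
    cases p with
    | nil =>
      obtain rfl : u = w := hp
      by_cases h : G.s e = u
      · subst h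
        have he : G.IsPath (G.s e) [e] (G.r e) := ⟨rfl, rfl⟩
        refine Or.inr ⟨G.r e, x, G.r e, [], q ++ [e], rfl, hq.append he, ?_⟩
        rw [ghostElt_append hq he, ghostElt_cons, pathElt_nil, pathElt_nil, ghostElt_nil,
          ← mul_assoc, ghost_mul_vert, ← mul_assoc, ← mul_assoc, vert_mul_self, vert_mul_ghost]
      · refine Or.inl ?_
        rw [pathElt_nil, ← ghost_mul_vert, mul_assoc, ← mul_assoc (G.vert _),
          vert_mul_vert_ne h, zero_mul, mul_zero]
    | cons f p =>
      obtain ⟨rfl, hp⟩ := hp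
      by_cases h : e = f
      · subst h
        refine Or.inr ⟨G.r e, x, w, p, q, hp, hq, ?_⟩
        rw [pathElt_cons, ← mul_assoc, ← mul_assoc, ghost_mul_edge, vert_mul_pathElt]
      · refine Or.inl ?_
        rw [pathElt_cons, ← mul_assoc, ← mul_assoc, ghost_mul_edge_ne h, zero_mul, zero_mul]

theorem isNormal_gen (g : Gen G) : IsNormal (G.toInv (G.gen g)) := by
  have hv : ∀ y : G.V, IsNormal (G.vert y) := fun y =>
    Or.inr ⟨y, y, y, [], [], rfl, rfl, (vert_mul_self y).symm⟩
  cases g with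
  | vert y => exact hv y
  | edge e =>
    have h := isNormal_gen_mul (.edge e) (hv (G.r e))
    rwa [show G.toInv (G.gen (.edge e)) = G.edge e from rfl, edge_mul_vert] at h
  | ghost e =>
    have h := isNormal_gen_mul (.ghost e) (hv (G.s e))
    rwa [show G.toInv (G.gen (.ghost e)) = G.ghost e from rfl, ghost_mul_vert] at h

theorem isNormal (a : G.InvSemigroup) : IsNormal a := by
  obtain ⟨x, rfl⟩ : ∃ x, G.toInv x = a := Quotient.exists_rep a
  induction x using WithZero.recZeroCoe with
  | zero => exact Or.inl rfl
  | coe x =>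
    induction x using FreeSemigroup.recOnMul with
    | ih1 g => exact isNormal_gen g
    | ih2 g y _ ih => exact isNormal_gen_mul g ih

/-! ### Paths through vertices of index one -/

theorem eq_of_mem_indexOne {e f : G.E} (h : G.s e ∈ G.indexOne) (hef : G.s e = G.s f) :
    e = f := by
  obtain ⟨a, ha⟩ := Set.encard_eq_one.1 h
  have he : e ∈ ({a} : Set G.E) := ha ▸ rfl
  have hf : f ∈ ({a} : Set G.E) := ha ▸ hef.symm
  rw [Set.mem_singleton_iff.1 he, Set.mem_singleton_iff.1 hf]

/-- The next edge is forced at every source of `l`, so the two paths agree until one of them stops.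
-/
theorem prefix_or_prefix_of_indexOne {u w w' : G.V} {l l' : List G.E} (h : G.IsPath u l w)
    (h' : G.IsPath u l' w') (hl : ∀ e ∈ l, G.s e ∈ G.indexOne) : l <+: l' ∨ l' <+: l := by
  induction l generalizing u l' with
  | nil => exact Or.inl List.nil_prefix
  | cons e l ih =>
    cases l' with
    | nil => exact Or.inr List.nil_prefix
    | cons f l' =>
      obtain rfl := eq_of_mem_indexOne (hl e (by simp)) (h.1.trans h'.1.symm)
      simpa only [List.prefix_cons_inj] using
        ih h.2 h'.2 fun a ha => hl a (List.mem_cons_of_mem _ ha)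

theorem exists_eq_append_of_not_nodup_map {α β : Type*} {f : α → β} {l : List α}
    (h : ¬ (l.map f).Nodup) :
    ∃ a x b y d, l = a ++ x :: b ++ y :: d ∧ f x = f y := by
  induction l with
  | nil => simp at h
  | cons z l ih =>
    by_cases hl : (l.map f).Nodup
    · have hz : f z ∈ l.map f := by
        by_contra hz
        exact h (by rw [List.map_cons]; exact List.nodup_cons.2 ⟨hz, hl⟩)
      obtain ⟨y, hy, hyz⟩ := List.mem_map.1 hz
      obtain ⟨b, d, rfl⟩ := List.append_of_mem hy
      exact ⟨[], z, b, y, d, rfl, hyz.symm⟩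
    · obtain ⟨a, x, b, y, d, rfl, hxy⟩ := ih hl
      exact ⟨z :: a, x, b, y, d, rfl, hxy⟩

/-- A closed path through vertices of index one is a power of a cycle. -/
theorem exists_cycle_of_closed_path {W : Set G.V} (hW : W ⊆ G.indexOne) {u : G.V}
    {z : List G.E} (hz : G.IsPath u z u) (hne : z ≠ []) (hzW : ∀ e ∈ z, G.s e ∈ W) :
    ∃ c : G.Cycle, c ∈ G.cyclesIn W ∧ c.base = u ∧
      ∃ m : ℕ, z = (List.replicate m c.edges).flatten := by
  let P : ℕ → Prop := fun n =>
    ∃ l : List G.E, l.length = n ∧ l ≠ [] ∧ G.IsPath u l u ∧ ∀ e ∈ l, G.s e ∈ W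
  have hP : ∃ n, P n := ⟨_, z, rfl, hne, hz, hzW⟩
  classical
  -- The cycle is a shortest nonempty closed path at `u` inside `W`.
  obtain ⟨c, hcn, hc0, hcp, hcW⟩ := Nat.find_spec hP
  have hmin : ∀ l : List G.E, l ≠ [] → G.IsPath u l u → (∀ e ∈ l, G.s e ∈ W) →
      c.length ≤ l.length := fun l h0 hl hlW => by
    rw [hcn]; exact Nat.find_min' hP ⟨l, rfl, h0, hl, hlW⟩
  have hnodup : (c.map G.s).Nodup := by
    by_contra h
    obtain ⟨a, x, b, y, d, rfl, hxy⟩ := exists_eq_append_of_not_nodup_map h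
    obtain ⟨k, h1, h2⟩ := isPath_append.1 hcp
    obtain ⟨k', h3, -⟩ := isPath_append.1 h1
    -- Cutting out the loop `x :: b` between two edges with the same source leaves a shorter
    -- nonempty closed path.
    have h4 : G.IsPath u (a ++ y :: d) u :=
      h3.append ⟨hxy.symm.trans (isPath_append.1 h1 |>.elim fun k'' h => by
        rw [h3.range_unique h.1]; exact h.2.1), h2.2⟩
    have := hmin _ (by simp) h4 fun e he => hcW e (by
      simp only [List.mem_append, List.mem_cons] at he ⊢; tauto)
    simp at this
    omega
  refine ⟨⟨u, c, hc0, hcp, hnodup⟩, hcW, rfl, ?_⟩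
  change ∃ m : ℕ, z = (List.replicate m c).flatten
  -- The induction strips copies of `c` until the empty path is left, so `z` must be allowed to be
  -- empty.
  clear hne
  induction hn : z.length using Nat.strong_induction_on generalizing z with
  | _ n ih =>
    by_cases hz0 : z = []
    · exact ⟨0, hz0⟩
    have hlen := hmin z hz0 hz hzW
    obtain ⟨t, rfl⟩ : c <+: z := by
      rcases prefix_or_prefix_of_indexOne hcp hz fun e he => hW (hcW e he) with h | h
      · exact h
      · rw [h.eq_of_length_le hlen]
    have hc1 := List.length_pos_iff.2 hc0
    obtain ⟨m, hm⟩ := ih t.length (by simp at hn; omega) (hz.of_append hcp)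
      (fun e he => hzW e (List.mem_append_right _ he)) rfl
    exact ⟨m + 1, by rw [List.replicate_succ, List.flatten_cons, ← hm]⟩

theorem IsPath.rotate {u : G.V} {l : List G.E} (h : G.IsPath u l u) (n : ℕ) :
    ∃ w, G.IsPath w (l.rotate n) w := by
  induction n generalizing l u with
  | zero => exact ⟨u, by simpa using h⟩
  | succ n ih =>
    cases l with
    | nil => exact ⟨u, by simpa using h⟩
    | cons e l =>
      obtain ⟨rfl, h⟩ := h
      rw [List.rotate_cons_succ]
      exact ih (isPath_append_singleton h)

/-- Cycles through vertices of index one that share an edge are equal up to rotation. -/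
theorem Cycle.isRotated {W : Set G.V} (hW : W ⊆ G.indexOne) {c d : G.Cycle}
    (hc : c ∈ G.cyclesIn W) {e : G.E} (hec : e ∈ c.edges) (hed : e ∈ d.edges) :
    c.edges ~r d.edges := by
  -- Rotate each cycle so that it starts with the shared edge.
  have key : ∀ b : G.Cycle, e ∈ b.edges →
      ∃ l, b.edges ~r (e :: l) ∧ G.IsPath (G.s e) (e :: l) (G.s e) ∧
        ((e :: l).map G.s).Nodup := by
    intro b heb
    obtain ⟨l₁, l₂, hl⟩ := List.append_of_mem heb
    have hrot : b.edges.rotate l₁.length = e :: (l₂ ++ l₁) := by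
      rw [hl, List.rotate_append_length_eq]; rfl
    obtain ⟨w, hw⟩ := b.isPath.rotate l₁.length
    rw [hrot] at hw
    have hw' : G.s e = w := hw.1
    refine ⟨l₂ ++ l₁, ⟨l₁.length, hrot⟩, hw' ▸ hw, ?_⟩
    rw [← hrot, List.map_rotate, List.nodup_rotate]
    exact b.nodup
  obtain ⟨l, hl, hlp, hln⟩ := key c hec
  obtain ⟨k, hk, hkp, hkn⟩ := key d hed
  -- A proper closed prefix would bring the longer path back to `s(e)` too early, repeating a
  -- source.
  have aux : ∀ {a b : List G.E}, G.IsPath (G.s e) (e :: a) (G.s e) →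
      G.IsPath (G.s e) (e :: b) (G.s e) → ((e :: b).map G.s).Nodup →
      (e :: a) <+: (e :: b) → e :: a = e :: b := by
    rintro a b ha hb hn ⟨t, ht⟩
    cases t with
    | nil => simpa using ht
    | cons x t =>
      exfalso
      rw [← ht] at hb hn
      have hx : G.s x = G.s e := (hb.of_append ha).1
      rw [List.cons_append, List.map_cons, List.nodup_cons] at hn
      exact hn.1 (List.mem_map.2 ⟨x, by simp, hx⟩)
  have heq : e :: l = e :: k := by
    rcases prefix_or_prefix_of_indexOne hlp hkp
      (fun a ha => hW (hc a (hl.mem_iff.2 ha))) with h | h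
    · exact aux hlp hkp hkn h
    · exact (aux hkp hlp hln h).symm
  rw [heq] at hl
  exact hl.trans hk.symm

/-! ### A congruence is generated by its congruence triple -/

theorem isPath_closedPow {u : G.V} {l : List G.E} (h : G.IsPath u l u) (m : ℕ) :
    G.IsPath u (List.replicate m l).flatten u := by
  induction m with
  | zero => rfl
  | succ m ih => rw [List.replicate_succ, List.flatten_cons]; exact h.append ih

theorem closedPow_add {u : G.V} {l : List G.E} (h : G.IsPath u l u) (m n : ℕ) :
    G.closedPow u l (m + n) = G.closedPow u l m * G.closedPow u l n := by
  rw [closedPow, List.replicate_add, List.flatten_append, pathElt_append (isPath_closedPow h m)]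
  rfl

theorem closedPow_zero (u : G.V) (l : List G.E) : G.closedPow u l 0 = G.vert u := rfl

theorem closedPow_mul_add (τ : Con G.InvSemigroup) {u : G.V} {l : List G.E}
    (h : G.IsPath u l u) {k : ℕ} (hk : τ (G.closedPow u l k) (G.vert u)) (q r : ℕ) :
    τ (G.closedPow u l (k * q + r)) (G.closedPow u l r) := by
  induction q with
  | zero => rw [Nat.mul_zero, Nat.zero_add]; exact τ.refl _
  | succ q ih =>
    rw [Nat.mul_succ, Nat.add_right_comm, Nat.add_comm, closedPow_add h]
    refine τ.trans (τ.mul hk ih) ?_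
    rw [closedPow, vert_mul_pathElt]
    exact τ.refl _

theorem leastPos_eq_coe_iff {P : ℕ+ → Prop} {n : ℕ+} :
    leastPos P = (n : WithTop ℕ+) ↔ P n ∧ ∀ m, P m → n ≤ m := by
  classical
  unfold leastPos
  split_ifs with h
  · rw [WithTop.coe_inj]
    constructor
    · rintro rfl
      exact ⟨PNat.find_spec h, fun m hm => PNat.find_min' h hm⟩
    · rintro ⟨h1, h2⟩
      exact le_antisymm (PNat.find_min' h h1) (h2 _ (PNat.find_spec h))
  · exact ⟨fun h' => absurd h'.symm (WithTop.coe_ne_top), fun h' => absurd ⟨n, h'.1⟩ h⟩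

theorem leastPos_eq_top_iff {P : ℕ+ → Prop} : leastPos P = ⊤ ↔ ∀ m, ¬ P m := by
  unfold leastPos
  split_ifs with h
  · exact ⟨fun h' => absurd h' WithTop.coe_ne_top, fun h' => absurd h (not_exists.2 h')⟩
  · exact ⟨fun _ => not_exists.1 h, fun _ => rfl⟩

/-- Edges `e` outside the zero set of `ρ` with `e e* ρ s(e)`. -/
def IsInvertible (ρ : Con G.InvSemigroup) (e : G.E) : Prop :=
  G.r e ∉ zeroSet ρ ∧ ρ (G.edge e * G.ghost e) (G.vert (G.s e))

/-- One such edge suffices: a second edge `f` of `G \ H` with the same source would give `r(f) = f*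
s(e) f ρ f* e e* f = 0`. -/
theorem IsInvertible.mem_conW {ρ : Con G.InvSemigroup} {e : G.E} (he : IsInvertible ρ e) :
    (G.delete (zeroSet ρ) (isHereditary_zeroSet ρ)).s ⟨e, he.1⟩ ∈ conW ρ := by
  refine ⟨⟨_, rfl⟩, ?_⟩
  rintro ⟨f, hf⟩ hfe
  have hs : G.s f = G.s e := congrArg Subtype.val hfe
  by_cases hef : e = f
  · subst hef; exact he.2
  · exfalso
    have h := ρ.mul (ρ.refl (G.ghost f)) (ρ.mul he.2 (ρ.refl (G.edge f)))
    rw [← hs, vert_mul_edge, ghost_mul_edge, mul_assoc, ghost_mul_edge_ne hef, mul_zero,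
      mul_zero] at h
    exact hf (ρ.symm h)

theorem tripleCon_le (ρ : Con G.InvSemigroup) : tripleCon (conTriple ρ) ≤ ρ := by
  refine Con.conGen_le.2 fun a b h => ?_
  cases h with
  | zero v hv => exact hv
  | edge e he => exact he.2 e rfl
  | cycle c m hm => exact (leastPos_eq_coe_iff.1 hm).1

theorem tripleCon_vert_zero {ρ : Con G.InvSemigroup} {w : G.V} (hw : w ∈ zeroSet ρ) :
    tripleCon (conTriple ρ) (G.vert w) 0 :=
  ConGen.Rel.of _ _ (TripleRel.zero (t := conTriple ρ) w hw)

theorem IsInvertible.tripleCon {ρ : Con G.InvSemigroup} {e : G.E} (he : IsInvertible ρ e) :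
    tripleCon (conTriple ρ) (G.edge e * G.ghost e) (G.vert (G.s e)) :=
  ConGen.Rel.of _ _ (TripleRel.edge (t := conTriple ρ) ⟨e, he.1⟩ he.mem_conW)

/-- Use `p*(p q*)q = w` one way and `p w q* = p q*` the other. -/
theorem mul_ghostElt_rel_zero_iff (τ : Con G.InvSemigroup) {u x w : G.V} {p q : List G.E}
    (hp : G.IsPath u p w) (hq : G.IsPath x q w) :
    τ (G.pathElt u p * ghostElt x q) 0 ↔ τ (G.vert w) 0 := by
  constructor
  · intro h
    have h := τ.mul (τ.mul (τ.refl (ghostElt u p)) h) (τ.refl (G.pathElt x q))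
    rwa [← mul_assoc, ghostElt_mul_pathElt hp, vert_mul_ghostElt hq, ghostElt_mul_pathElt hq,
      mul_zero, zero_mul] at h
  · intro h
    have h := τ.mul (τ.mul (τ.refl (G.pathElt u p)) h) (τ.refl (ghostElt x q))
    rwa [pathElt_mul_vert hp, mul_zero, zero_mul] at h

/-- Multiplying on the left by `e e*` fixes `e a` and sends `s(e)` to `e e*`, so `e a ρ e e*`. -/
theorem isInvertible_of_edge_mul {ρ : Con G.InvSemigroup} {e : G.E} {a : G.InvSemigroup}
    (hs : G.s e ∉ zeroSet ρ) (h : ρ (G.edge e * a) (G.vert (G.s e))) : IsInvertible ρ e := by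
  have h2 : ρ (G.edge e * G.ghost e) (G.vert (G.s e)) := by
    have h1 := ρ.mul (ρ.refl (G.edge e * G.ghost e)) h
    rw [mul_assoc (G.edge e) (G.ghost e) (G.vert _), ghost_mul_vert, ← mul_assoc,
      mul_assoc (G.edge e), ghost_mul_edge, edge_mul_vert] at h1
    exact ρ.trans (ρ.symm h1) h
  refine ⟨fun hr => hs ?_, h2⟩
  have h3 := ρ.mul (ρ.mul (ρ.refl (G.edge e)) hr) (ρ.refl (G.ghost e))
  rw [edge_mul_vert, mul_zero, zero_mul] at h3
  exact ρ.trans (ρ.symm h2) h3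

/-- The first edge is invertible by `isInvertible_of_edge_mul`; sandwiching between `e*` and `e`
passes the hypothesis on to the tail. -/
theorem isInvertible_of_pathElt_mul_ghostElt {ρ : Con G.InvSemigroup} {u w : G.V}
    {l : List G.E} (hl : G.IsPath u l w) (hu : u ∉ zeroSet ρ)
    (h : ρ (G.pathElt u l * ghostElt u l) (G.vert u)) : ∀ e ∈ l, IsInvertible ρ e := by
  induction l generalizing u with
  | nil => simp
  | cons e l ih =>
    obtain ⟨rfl, hl⟩ := hl
    rw [pathElt_cons, ghostElt_cons] at h
    have he : IsInvertible ρ e := isInvertible_of_edge_mul hu (by rwa [mul_assoc] at h)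
    have h1 := ρ.mul (ρ.mul (ρ.refl (G.ghost e)) h) (ρ.refl (G.edge e))
    rw [ghost_mul_vert, ghost_mul_edge, ← mul_assoc, ← mul_assoc, ← mul_assoc, ghost_mul_edge,
      vert_mul_pathElt, mul_assoc, mul_assoc, ghost_mul_edge,
      ghostElt_mul_vert hl] at h1
    intro f hf
    rcases List.mem_cons.1 hf with rfl | hf
    · exact he
    · exact ih hl he.1 h1 f hf

theorem tripleCon_pathElt_mul_ghostElt {ρ : Con G.InvSemigroup} {u w : G.V}
    {l : List G.E} (hl : G.IsPath u l w) (h : ∀ e ∈ l, IsInvertible ρ e) :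
    tripleCon (conTriple ρ) (G.pathElt u l * ghostElt u l) (G.vert u) := by
  set σ := tripleCon (conTriple ρ)
  induction l generalizing u with
  | nil => rw [pathElt_nil, ghostElt_nil, vert_mul_self]; exact σ.refl _
  | cons e l ih =>
    obtain ⟨rfl, hl⟩ := hl
    have h1 := ih hl fun f hf => h f (List.mem_cons_of_mem _ hf)
    have h2 := σ.mul (σ.mul (σ.refl (G.edge e)) h1) (σ.refl (G.ghost e))
    rw [edge_mul_vert, ← mul_assoc] at h2
    rw [pathElt_cons, ghostElt_cons, ← mul_assoc]
    exact σ.trans h2 (h e (by simp)).tripleCon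

theorem exists_isPath_delete {H : Set G.V} (hH : G.IsHereditary H) {u w : G.V} {l : List G.E}
    (hl : G.IsPath u l w) (hw : w ∉ H) :
    ∃ (hu : u ∉ H) (l' : List (G.delete H hH).E), l'.map Subtype.val = l ∧
      (G.delete H hH).IsPath ⟨u, hu⟩ l' ⟨w, hw⟩ := by
  induction l generalizing u with
  | nil => obtain rfl : u = w := hl; exact ⟨hw, [], rfl, rfl⟩
  | cons e l ih =>
    obtain ⟨rfl, hl⟩ := hl
    obtain ⟨hr, l', rfl, hl'⟩ := ih hl
    exact ⟨fun h => hr (hH e h), ⟨e, hr⟩ :: l', rfl, rfl, hl'⟩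

theorem ghostElt_rel_of_pathElt_rel {τ : Con G.InvSemigroup} {u : G.V} {z : List G.E}
    (hz : G.IsPath u z u) (h : τ (G.pathElt u z) (G.vert u)) :
    τ (ghostElt u z) (G.vert u) := by
  have h1 := τ.mul (τ.refl (ghostElt u z)) h
  rw [ghostElt_mul_pathElt hz, ghostElt_mul_vert hz] at h1
  exact τ.symm h1

theorem pathElt_rel_of_ghostElt_rel {τ : Con G.InvSemigroup} {u : G.V} {z : List G.E}
    (hz : G.IsPath u z u) (h : τ (ghostElt u z) (G.vert u)) :
    τ (G.pathElt u z) (G.vert u) := by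
  have h1 := τ.mul h (τ.refl (G.pathElt u z))
  rw [ghostElt_mul_pathElt hz, vert_mul_pathElt] at h1
  exact τ.symm h1

theorem isInvertible_of_closed {ρ : Con G.InvSemigroup} {u : G.V} {z : List G.E}
    (hz : G.IsPath u z u) (hu : u ∉ zeroSet ρ) (h : ρ (G.pathElt u z) (G.vert u)) :
    ∀ e ∈ z, IsInvertible ρ e := by
  refine isInvertible_of_pathElt_mul_ghostElt hz hu ?_
  have h1 := ρ.mul h (ghostElt_rel_of_pathElt_rel hz h)
  rwa [vert_mul_self] at h1

/-- This is where the cycle function enters: the closed path is a power of a cycle in `W`, with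
exponent a multiple of the least admissible one. -/
theorem tripleCon_of_closed {ρ : Con G.InvSemigroup} {u : G.V} {z : List G.E}
    (hz : G.IsPath u z u) (hu : u ∉ zeroSet ρ) (h : ρ (G.pathElt u z) (G.vert u)) :
    tripleCon (conTriple ρ) (G.pathElt u z) (G.vert u) := by
  by_cases hne : z = []
  · subst hne; exact (tripleCon (conTriple ρ)).refl _
  have hinv := isInvertible_of_closed hz hu h
  obtain ⟨_, z, rfl, hz'⟩ := exists_isPath_delete (isHereditary_zeroSet ρ) hz hu
  obtain ⟨c, hcW, hcu, m, rfl⟩ := exists_cycle_of_closed_path (conW_subset_indexOne ρ) hz'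
    (mt List.map_eq_nil_iff.2 hne)
    fun e he => (hinv e.1 (List.mem_map_of_mem he)).mem_conW
  have hcp := isPath_map_val c.isPath
  obtain rfl : c.base.1 = u := congrArg Subtype.val hcu
  rw [List.map_flatten, List.map_replicate] at h hne ⊢
  change ρ (G.closedPow _ _ m) _ at h
  change tripleCon _ (G.closedPow _ _ m) _
  have hm : 0 < m := Nat.pos_of_ne_zero fun h0 => hne (by rw [h0]; rfl)
  have hP : ∃ n : ℕ+, conF ρ c = n := by
    cases hf : conF ρ c with
    | top => exact absurd h (leastPos_eq_top_iff.1 hf ⟨m, hm⟩)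
    | coe n => exact ⟨n, rfl⟩
  obtain ⟨k, hk⟩ := hP
  have hkσ : tripleCon (conTriple ρ) (deletePow c k) (G.vert c.base.1) :=
    ConGen.Rel.of _ _ (TripleRel.cycle (t := conTriple ρ) ⟨c, hcW⟩ k hk)
  obtain ⟨hkρ, hmin⟩ := leastPos_eq_coe_iff.1 hk
  -- A nonzero remainder would be an admissible exponent below the minimum `k`.
  have hr : m % k = 0 := by
    by_contra h0
    have h1 := closedPow_mul_add ρ hcp hkρ (m / k) (m % k)
    rw [Nat.div_add_mod] at h1
    exact absurd (hmin ⟨m % k, Nat.pos_of_ne_zero h0⟩ (ρ.trans (ρ.symm h1) h))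
      (not_le.2 (Nat.mod_lt m k.pos))
  have h2 := closedPow_mul_add _ hcp hkσ (m / k) (m % k)
  rwa [Nat.div_add_mod, hr, closedPow_zero] at h2

/-- If both paths are nonempty, they start with the same edge, which can be stripped by `e* _ e` and
restored by `e _ e*`. Once one path is empty, the other is closed. -/
theorem tripleCon_of_pathElt_mul_ghostElt {ρ : Con G.InvSemigroup} {u w : G.V}
    {z y : List G.E} (hz : G.IsPath u z w) (hy : G.IsPath u y w) (hu : u ∉ zeroSet ρ)
    (h : ρ (G.pathElt u z * ghostElt u y) (G.vert u)) :
    tripleCon (conTriple ρ) (G.pathElt u z * ghostElt u y) (G.vert u) := by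
  induction z generalizing u y with
  | nil =>
    obtain rfl : u = w := hz
    rw [pathElt_nil, vert_mul_ghostElt hy] at h ⊢
    exact ghostElt_rel_of_pathElt_rel hy
      (tripleCon_of_closed hy hu (pathElt_rel_of_ghostElt_rel hy h))
  | cons e z ih =>
    cases y with
    | nil =>
      obtain rfl : u = w := hy
      rw [ghostElt_nil, pathElt_mul_vert hz] at h ⊢
      exact tripleCon_of_closed hz hu h
    | cons f y =>
      obtain ⟨rfl, hz⟩ := hz
      obtain ⟨hs, hy⟩ := hy
      rw [pathElt_cons, ghostElt_cons] at h ⊢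
      have he : IsInvertible ρ e := isInvertible_of_edge_mul hu (by rwa [mul_assoc] at h)
      have h1 := ρ.mul (ρ.mul (ρ.refl (G.ghost e)) h) (ρ.refl (G.edge e))
      rw [ghost_mul_vert, ghost_mul_edge, ← mul_assoc, ← mul_assoc, ← mul_assoc,
        ghost_mul_edge, vert_mul_pathElt] at h1
      -- Otherwise `f* e = 0` would put `r(e)` into the zero set.
      have hfe : f = e := by
        by_contra hne
        rw [mul_assoc, ghost_mul_edge_ne hne, mul_zero] at h1
        exact he.1 (ρ.symm h1)
      subst hfe
      rw [mul_assoc, mul_assoc, ghost_mul_edge, ghostElt_mul_vert hy] at h1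
      set σ := tripleCon (conTriple ρ)
      have h2 := σ.mul (σ.mul (σ.refl (G.edge f)) (ih hz hy he.1 h1)) (σ.refl (G.ghost f))
      rw [edge_mul_vert] at h2
      have h3 := σ.trans h2 he.tripleCon
      simpa only [mul_assoc] using h3

/-- With `p' = p z`, the relation becomes `w ρ z (q'* q)`, and the comparison of `q` with `q'`
leaves a closed path `z y` or a product `z y*`. -/
theorem tripleCon_of_isPrefix {ρ : Con G.InvSemigroup} {u x w w' : G.V}
    {p q p' q' : List G.E} (hp : G.IsPath u p w) (hq : G.IsPath x q w)
    (hp' : G.IsPath u p' w') (hq' : G.IsPath x q' w') (hw : w ∉ zeroSet ρ) (hpp : p <+: p')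
    (h : ρ (G.pathElt u p * ghostElt x q) (G.pathElt u p' * ghostElt x q')) :
    tripleCon (conTriple ρ) (G.pathElt u p * ghostElt x q)
      (G.pathElt u p' * ghostElt x q') := by
  obtain ⟨z, rfl⟩ := hpp
  have hz : G.IsPath w z w' := hp'.of_append hp
  have h1 := ρ.mul (ρ.mul (ρ.refl (ghostElt u p)) h) (ρ.refl (G.pathElt x q))
  rw [← mul_assoc, ghostElt_mul_pathElt hp, vert_mul_ghostElt hq, ghostElt_mul_pathElt hq,
    ← mul_assoc, ghostElt_mul_pathElt_append hp, mul_assoc] at h1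
  rw [pathElt_append hp]
  set σ := tripleCon (conTriple ρ) with hσ
  rcases prefix_or_prefix_or_ghostElt_mul_eq_zero hq' hq with ⟨y, rfl⟩ | ⟨y, rfl⟩ | h0
  · have hy : G.IsPath w' y w := hq.of_append hq'
    rw [ghostElt_mul_pathElt_append hq', ← pathElt_append hz] at h1
    have h2 := tripleCon_of_closed (hz.append hy) hw (ρ.symm h1)
    have hinv := isInvertible_of_closed (hz.append hy) hw (ρ.symm h1)
    have h3 := tripleCon_pathElt_mul_ghostElt hy
      fun e he => hinv e (List.mem_append_right _ he)
    rw [pathElt_append hz] at h2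
    rw [← hσ] at h2 h3
    -- Here `z σ z y y* σ y*`: invertibility of the edges of `y` first, then `z y σ w`.
    have h4 : σ (G.pathElt w z) (ghostElt w' y) := by
      have h5 := σ.mul (σ.refl (G.pathElt w z)) h3
      have h6 := σ.mul h2 (σ.refl (ghostElt w' y))
      rw [pathElt_mul_vert hz, ← mul_assoc] at h5
      rw [vert_mul_ghostElt hy] at h6
      exact σ.trans (σ.symm h5) h6
    rw [ghostElt_append hq' hy, ← mul_assoc]
    exact σ.mul (σ.mul (σ.refl _) (σ.symm h4)) (σ.refl _)
  · have hy : G.IsPath w y w' := hq'.of_append hq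
    rw [ghostElt_append_mul_pathElt hq hy] at h1
    have h2 := tripleCon_of_pathElt_mul_ghostElt hz hy hw (ρ.symm h1)
    have h3 := σ.mul (σ.mul (σ.refl (G.pathElt u p)) (σ.symm h2)) (σ.refl (ghostElt x q))
    rw [pathElt_mul_vert hp] at h3
    rw [ghostElt_append hq hy]
    simpa only [mul_assoc] using h3
  · rw [h0, mul_zero] at h1
    exact absurd h1 hw

theorem tripleCon_conTriple (ρ : Con G.InvSemigroup) : tripleCon (conTriple ρ) = ρ := by
  refine le_antisymm (tripleCon_le ρ) fun a b h => ?_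
  change tripleCon (conTriple ρ) a b
  set σ := tripleCon (conTriple ρ) with hσ
  have hzero : ∀ c, ρ c 0 → σ c 0 := by
    intro c hc
    obtain rfl | ⟨u, x, w, p, q, hp, hq, rfl⟩ := isNormal c
    · exact σ.refl _
    · exact (mul_ghostElt_rel_zero_iff σ hp hq).2
        (tripleCon_vert_zero ((mul_ghostElt_rel_zero_iff ρ hp hq).1 hc))
  by_cases ha : ρ a 0
  · exact σ.trans (hzero a ha) (σ.symm (hzero b (ρ.trans (ρ.symm h) ha)))
  have hb : ¬ ρ b 0 := fun hb => ha (ρ.trans h hb)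
  obtain rfl | ⟨u, x, w, p, q, hp, hq, rfl⟩ := isNormal a
  · exact absurd (ρ.refl 0) ha
  obtain rfl | ⟨u', x', w', p', q', hp', hq', rfl⟩ := isNormal b
  · exact absurd (ρ.refl 0) hb
  have hw : w ∉ zeroSet ρ := mt (mul_ghostElt_rel_zero_iff ρ hp hq).2 ha
  have hw' : w' ∉ zeroSet ρ := mt (mul_ghostElt_rel_zero_iff ρ hp' hq').2 hb
  -- The left side collapses to `w`, which is not related to zero, so neither `p* p'` nor `q'* q`
  -- can vanish.
  have h1 := ρ.mul (ρ.mul (ρ.refl (ghostElt u p)) h) (ρ.refl (G.pathElt x q))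
  rw [← mul_assoc, ghostElt_mul_pathElt hp, vert_mul_ghostElt hq, ghostElt_mul_pathElt hq,
    ← mul_assoc, mul_assoc] at h1
  have hu : u = u' := by
    by_contra hne
    rw [ghostElt_mul_pathElt_source_ne hp hne, zero_mul] at h1
    exact hw h1
  have hx : x = x' := by
    by_contra hne
    rw [ghostElt_mul_pathElt_source_ne hq' (Ne.symm hne), mul_zero] at h1
    exact hw h1
  subst hu hx
  rcases prefix_or_prefix_or_ghostElt_mul_eq_zero hp hp' with h2 | h2 | h2
  · exact tripleCon_of_isPrefix hp hq hp' hq' hw h2 h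
  · exact σ.symm (tripleCon_of_isPrefix hp' hq' hp hq hw' h2 (ρ.symm h))
  · rw [h2, zero_mul] at h1
    exact absurd h1 hw

end DirectedGraph

/-! ### Relations under composition, the target of the models -/

/-- Binary relations on a type, as a semigroup with zero under composition. -/
def EndoRel (X : Type*) := X → X → Prop

instance (X : Type*) : SemigroupWithZero (EndoRel X) where
  mul a b := fun x z => ∃ y, a x y ∧ b y z
  zero := fun _ _ => False
  mul_assoc a b c := by
    funext x z
    refine propext ⟨?_, ?_⟩
    · rintro ⟨y, ⟨t, h1, h2⟩, h3⟩; exact ⟨t, h1, y, h2, h3⟩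
    · rintro ⟨y, h1, t, h2, h3⟩; exact ⟨t, ⟨y, h1, h2⟩, h3⟩
  zero_mul a := by
    funext x z
    exact propext ⟨fun ⟨_, h, _⟩ => h, False.elim⟩
  mul_zero a := by
    funext x z
    exact propext ⟨fun ⟨_, _, h⟩ => h, False.elim⟩

theorem EndoRel.mul_apply {X : Type*} (a b : EndoRel X) (x z : X) :
    (a * b) x z ↔ ∃ y, a x y ∧ b y z := Iff.rfl

theorem EndoRel.ext_iff {X : Type*} {a b : EndoRel X} : a = b ↔ ∀ x y, a x y ↔ b x y :=
  ⟨fun h _ _ => h ▸ Iff.rfl, fun h => funext fun x => funext fun y => propext (h x y)⟩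

namespace DirectedGraph

variable {G : DirectedGraph.{u, v}}

/-! ### Representations by partial injections -/

/-- Injections of a type `Y`, one for each edge of `G`, such that, outside a hereditary set `H`,
distinct edges with a common source have disjoint images. -/
structure Representation (G : DirectedGraph.{u, v}) (H : Set G.V) (Y : Type*) where
  /-- the map attached to an edge -/
  map : G.E → Y → Y
  hereditary : G.IsHereditary H
  injective : ∀ e, Function.Injective (map e)
  disjoint : ∀ e f, G.s e = G.s f → G.r e ∉ H → G.r f ∉ H → ∀ y z, map e y = map f z → e = f

namespace Representation

variable {H : Set G.V} {Y : Type*} (φ : Representation G H Y)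

/-- The relation attached to a generator. -/
def ofGen : Gen G → EndoRel (G.V × Y)
  | .vert v => fun a b => a = b ∧ b.1 = v ∧ v ∉ H
  | .edge e => fun a b => G.r e ∉ H ∧ b.1 = G.r e ∧ a = (G.s e, φ.map e b.2)
  | .ghost e => fun b a => G.r e ∉ H ∧ b.1 = G.r e ∧ a = (G.s e, φ.map e b.2)

/-- The relation attached to an element of the free semigroup with zero. -/
def ofFree : G.FreeZero → EndoRel (G.V × Y) :=
  WithZero.recZeroCoe 0 (FreeSemigroup.lift φ.ofGen)

theorem ofFree_mul (x y : G.FreeZero) : φ.ofFree (x * y) = φ.ofFree x * φ.ofFree y := by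
  induction x using WithZero.recZeroCoe with
  | zero => rw [zero_mul]; exact (zero_mul _).symm
  | coe x =>
    induction y using WithZero.recZeroCoe with
    | zero => rw [mul_zero]; exact (mul_zero _).symm
    | coe y => exact map_mul (FreeSemigroup.lift φ.ofGen) x y

theorem ofFree_gen (g : Gen G) : φ.ofFree (G.gen g) = φ.ofGen g :=
  FreeSemigroup.lift_of _ _

/-- Injectivity gives `e*e = r(e)`, disjointness of images gives `f*e = 0`, and heredity keeps
sources of surviving edges outside `H`. -/
theorem ofFree_rel {x y : G.FreeZero} (h : G.Rel x y) : φ.ofFree x = φ.ofFree y := by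
  have hz : φ.ofFree 0 = 0 := rfl
  have hs : ∀ e, G.r e ∉ H → G.s e ∉ H := fun e => mt (φ.hereditary e)
  cases h <;> simp only [ofFree_mul, ofFree_gen, hz, EndoRel.ext_iff, EndoRel.mul_apply] <;>
    rintro ⟨x, y⟩ ⟨z, w⟩
  case gi1_same u => simp only [ofGen]; aesop
  case gi1_ne u v h =>
    refine ⟨?_, False.elim⟩
    rintro ⟨⟨a, b⟩, ⟨h1, h2, -⟩, h3, h4, -⟩
    exact h (h2.symm.trans ((congrArg Prod.fst h3).trans h4))
  case gi2_source e =>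
    refine ⟨?_, fun h => ⟨_, ⟨rfl, congrArg Prod.fst h.2.2, hs e h.1⟩, h⟩⟩
    rintro ⟨a, ⟨rfl, -⟩, h⟩; exact h
  case gi2_range e =>
    refine ⟨?_, fun h => ⟨_, h, rfl, h.2.1, h.1⟩⟩
    rintro ⟨a, h, rfl, -⟩; exact h
  case gi3_range e =>
    refine ⟨?_, fun h => ⟨_, ⟨rfl, h.2.1, h.1⟩, h⟩⟩
    rintro ⟨a, ⟨rfl, -⟩, h⟩; exact h
  case gi3_source e =>
    refine ⟨?_, fun h => ⟨_, h, rfl, congrArg Prod.fst h.2.2, hs e h.1⟩⟩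
    rintro ⟨a, h, rfl, -⟩; exact h
  case ck1_same e =>
    constructor
    · rintro ⟨⟨a, b⟩, ⟨h1, h2, h3⟩, -, h5, h6⟩
      have h7 := φ.injective e (congrArg Prod.snd (h3.symm.trans h6))
      exact ⟨Prod.ext (h2.trans h5.symm) h7, h5, h1⟩
    · rintro ⟨h1, h2, h3⟩
      rw [h1]
      exact ⟨_, ⟨h3, h2, rfl⟩, h3, h2, rfl⟩
  case ck1_ne f e h =>
    refine ⟨?_, False.elim⟩
    rintro ⟨⟨a, b⟩, ⟨h1, h2, h3⟩, h4, h5, h6⟩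
    have h7 := h3.symm.trans h6
    exact h (φ.disjoint f e (congrArg Prod.fst h7) h1 h4 _ _ (congrArg Prod.snd h7))

/-- The congruence on the free semigroup with zero that a representation induces. -/
def freeKer : Con G.FreeZero where
  toSetoid := Setoid.ker φ.ofFree
  mul' {a b c d} h1 h2 := by
    change φ.ofFree _ = φ.ofFree _
    rw [ofFree_mul, ofFree_mul, show φ.ofFree a = _ from h1, show φ.ofFree c = _ from h2]

/-- The action of the graph inverse semigroup on `V × Y` by partial injections. -/
def toRel : G.InvSemigroup → EndoRel (G.V × Y) :=
  Quotient.lift φ.ofFree fun _ _ h =>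
    Con.conGen_le.2 (show G.Rel ≤ φ.freeKer from fun _ _ h => φ.ofFree_rel h) h

theorem toRel_mul (a b : G.InvSemigroup) : φ.toRel (a * b) = φ.toRel a * φ.toRel b := by
  induction a, b using Quotient.inductionOn₂ with
  | _ a b => exact φ.ofFree_mul a b

theorem toRel_vert (u : G.V) (a b : G.V × Y) :
    φ.toRel (G.vert u) a b ↔ a = b ∧ b.1 = u ∧ u ∉ H :=
  EndoRel.ext_iff.1 (φ.ofFree_gen (.vert u)) a b

theorem toRel_edge (e : G.E) (a b : G.V × Y) :
    φ.toRel (G.edge e) a b ↔ G.r e ∉ H ∧ b.1 = G.r e ∧ a = (G.s e, φ.map e b.2) :=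
  EndoRel.ext_iff.1 (φ.ofFree_gen (.edge e)) a b

theorem toRel_ghost (e : G.E) (a b : G.V × Y) :
    φ.toRel (G.ghost e) a b ↔ G.r e ∉ H ∧ a.1 = G.r e ∧ b = (G.s e, φ.map e a.2) :=
  EndoRel.ext_iff.1 (φ.ofFree_gen (.ghost e)) a b

/-- When `r(e) ∉ H`, `e e*` is the identity on the image of the map of `e`, so it acts as `s(e)`
exactly when that map is onto. -/
theorem toRel_edge_mul_ghost (e : G.E) (a b : G.V × Y) :
    φ.toRel (G.edge e * G.ghost e) a b ↔
      G.r e ∉ H ∧ a = b ∧ ∃ y, b = (G.s e, φ.map e y) := by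
  simp only [toRel_mul, EndoRel.mul_apply, toRel_edge, toRel_ghost]
  constructor
  · rintro ⟨⟨x, y⟩, ⟨h1, h2, h3⟩, h4, h5, h6⟩
    exact ⟨h1, h3.trans h6.symm, y, h6⟩
  · rintro ⟨h1, rfl, y, rfl⟩
    exact ⟨(G.r e, y), ⟨h1, rfl, rfl⟩, h1, rfl, rfl⟩

theorem toRel_pathElt {u w : G.V} {l : List G.E} (hl : G.IsPath u l w) (hw : w ∉ H)
    (a b : G.V × Y) :
    φ.toRel (G.pathElt u l) a b ↔ b.1 = w ∧ a = (u, l.foldr φ.map b.2) := by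
  induction l generalizing u a with
  | nil =>
    obtain rfl : u = w := hl
    rw [pathElt_nil, toRel_vert]
    exact ⟨fun h => ⟨h.2.1, h.1.trans (Prod.ext h.2.1 rfl)⟩,
      fun h => ⟨h.2.trans (Prod.ext h.1.symm rfl), h.1, hw⟩⟩
  | cons e l ih =>
    obtain ⟨rfl, hl⟩ := hl
    have hr : G.r e ∉ H := (exists_isPath_delete φ.hereditary hl hw).1
    simp only [pathElt_cons, toRel_mul, EndoRel.mul_apply, toRel_edge, ih hl]
    constructor
    · rintro ⟨y, ⟨h1, h2, h3⟩, h4, rfl⟩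
      exact ⟨h4, h3⟩
    · rintro ⟨h1, h2⟩
      exact ⟨(G.r e, _), ⟨hr, rfl, h2⟩, h1, rfl⟩

/-- The congruence on the graph inverse semigroup that a representation induces. -/
def ker : Con G.InvSemigroup where
  toSetoid := Setoid.ker φ.toRel
  mul' {a b c d} h1 h2 := by
    change φ.toRel _ = φ.toRel _
    rw [toRel_mul, toRel_mul, show φ.toRel a = _ from h1, show φ.toRel c = _ from h2]

theorem ker_iff {a b : G.InvSemigroup} : φ.ker a b ↔ φ.toRel a = φ.toRel b := Iff.rfl

end Representation

/-! ### The congruence triple of the congruence of a congruence triple -/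

section Twist

variable (t : G.CongruenceTriple) {A : Type*} [AddCommGroup A] (δ : G.E → A)

open Classical in
/-- The representation on words over the edges together with an element of `A`: an edge with source
in `W` leaves the word unchanged, any other edge is prepended to the word; each edge `e` adds `δ e`
to the second component. -/
noncomputable def twist : Representation G t.H (List G.E × A) where
  map e y := (if G.s e ∈ Subtype.val '' t.pair.W then y.1 else e :: y.1, δ e + y.2)
  hereditary := t.hereditary
  injective e y z h := by
    have h1 := congrArg Prod.fst h
    have h2 := add_left_cancel (congrArg Prod.snd h)
    dsimp only at h1
    refine Prod.ext ?_ h2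
    split_ifs at h1
    · exact h1
    · exact (List.cons.inj h1).2
  disjoint e f hs he hf y z h := by
    have h1 := congrArg Prod.fst h
    dsimp only at h1
    rw [hs] at h1
    -- Over `W` the edge is unique in `G \ H`; elsewhere the prepended letter identifies it.
    split_ifs at h1 with hW
    · obtain ⟨w, hw, hwf⟩ := hW
      have := eq_of_mem_indexOne (G := G.delete t.H t.hereditary) (e := ⟨e, he⟩) (f := ⟨f, hf⟩)
        (by
          have : (G.delete t.H t.hereditary).s ⟨e, he⟩ = w :=
            Subtype.ext (hs.trans hwf.symm)
          rw [this]
          exact t.pair.subset_indexOne hw) (Subtype.ext hs)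
      exact congrArg Subtype.val this
    · exact (List.cons.inj h1).1

theorem twist_map_of_mem {e : (G.delete t.H t.hereditary).E}
    (he : (G.delete t.H t.hereditary).s e ∈ t.pair.W) (y : List G.E × A) :
    (twist t δ).map e.1 y = (y.1, δ e.1 + y.2) :=
  Prod.ext (if_pos ⟨_, he, rfl⟩) rfl

theorem twist_map_of_notMem {e : (G.delete t.H t.hereditary).E}
    (he : (G.delete t.H t.hereditary).s e ∉ t.pair.W) (y : List G.E × A) :
    (twist t δ).map e.1 y = (e.1 :: y.1, δ e.1 + y.2) := by
  refine Prod.ext (if_neg ?_) rfl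
  rintro ⟨w, hw, h⟩
  exact he ((Subtype.ext h : w = (G.delete t.H t.hereditary).s e) ▸ hw)

theorem twist_foldr {l : List (G.delete t.H t.hereditary).E}
    (hl : ∀ e ∈ l, (G.delete t.H t.hereditary).s e ∈ t.pair.W) (y : List G.E × A) :
    (l.map Subtype.val).foldr (twist t δ).map y =
      (y.1, (l.map fun e => δ e.1).sum + y.2) := by
  induction l with
  | nil => simp
  | cons e l ih =>
    rw [List.map_cons, List.foldr_cons, ih fun f hf => hl f (List.mem_cons_of_mem _ hf),
      twist_map_of_mem t δ (hl e (by simp)), List.map_cons, List.sum_cons, add_assoc]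

/-- Along `W` words do not change, so `c ^ m` acts at its base as translation by `m` times the total
of `δ` over `c`. -/
theorem twist_ker_deletePow {c : (G.delete t.H t.hereditary).Cycle}
    (hc : c ∈ (G.delete t.H t.hereditary).cyclesIn t.pair.W) (m : ℕ) :
    (twist t δ).ker (deletePow c m) (G.vert c.base.1) ↔
      m • (c.edges.map fun e => δ e.1).sum = 0 := by
  have hp := isPath_map_val (isPath_closedPow c.isPath m)
  have hs : (((List.replicate m c.edges).flatten).map fun e => δ e.1).sum =
      m • (c.edges.map fun e => δ e.1).sum := by
    simp [List.map_flatten, List.sum_flatten]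
  have hd : deletePow c m = G.pathElt c.base.1
      ((List.replicate m c.edges).flatten.map Subtype.val) := by
    rw [deletePow, closedPow, List.map_flatten, List.map_replicate]
  have hW : ∀ e ∈ (List.replicate m c.edges).flatten,
      (G.delete t.H t.hereditary).s e ∈ t.pair.W := by
    intro e he
    obtain ⟨l, hl, hel⟩ := List.mem_flatten.1 he
    rw [List.eq_of_mem_replicate hl] at hel
    exact hc e hel
  rw [Representation.ker_iff, EndoRel.ext_iff, hd]
  simp only [(twist t δ).toRel_pathElt hp c.base.2, (twist t δ).toRel_vert,
    twist_foldr t δ hW, hs]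
  constructor
  · intro h
    have h1 := ((h (c.base.1, [], 0) (c.base.1, [], 0)).2 ⟨rfl, rfl, c.base.2⟩).2
    simpa using (congrArg (fun a => a.2.2) h1).symm
  · rintro h ⟨x, l, a⟩ ⟨x', l', a'⟩
    rw [h, zero_add]
    exact ⟨fun ⟨h1, h2⟩ => ⟨h2.trans (by rw [← h1]), h1, c.base.2⟩,
      fun ⟨h1, h2, _⟩ => ⟨h2, h1.trans (by rw [← h2])⟩⟩

theorem tripleCon_le_twist_ker
    (h : ∀ (c : (G.delete t.H t.hereditary).cyclesIn t.pair.W) (m : ℕ+),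
      t.pair.f c = m → (m : ℕ) • (c.1.edges.map fun e => δ e.1).sum = 0) :
    tripleCon t ≤ (twist t δ).ker := by
  refine Con.conGen_le.2 fun a b hab => ?_
  cases hab with
  | zero v hv =>
    refine (Representation.ker_iff _).2 (EndoRel.ext_iff.2 fun a b => ?_)
    rw [Representation.toRel_vert]
    exact ⟨fun h => h.2.2 hv, False.elim⟩
  | edge e he =>
    refine (Representation.ker_iff _).2 (EndoRel.ext_iff.2 fun a b => ?_)
    rw [Representation.toRel_vert, Representation.toRel_edge_mul_ghost]
    constructor
    · rintro ⟨h1, h2, y, rfl⟩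
      exact ⟨h2, rfl, ((G.delete t.H t.hereditary).s e).2⟩
    · rintro ⟨h1, h2, h3⟩
      -- An edge leaving `W` acts by a translation, which is onto because `A` is a group.
      refine ⟨e.2, h1, (b.2.1, - δ e.1 + b.2.2), ?_⟩
      rw [twist_map_of_mem t δ he, add_neg_cancel_left]
      exact Prod.ext h2 rfl
  | cycle c m hm => exact (twist_ker_deletePow t δ c.2 m).2 (h c m hm)

end Twist

theorem zeroSet_tripleCon (t : G.CongruenceTriple) : zeroSet (tripleCon t) = t.H := by
  refine Set.Subset.antisymm (fun v hv => ?_) fun v hv =>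
    ConGen.Rel.of _ _ (TripleRel.zero v hv)
  by_contra hvH
  have h := tripleCon_le_twist_ker t (fun _ => (0 : ℤ)) (by simp) hv
  rw [Representation.ker_iff, EndoRel.ext_iff] at h
  have h1 := h (v, [], 0) (v, [], 0)
  rw [Representation.toRel_vert] at h1
  exact h1.1 ⟨rfl, rfl, hvH⟩

theorem mem_W_iff_tripleCon (t : G.CongruenceTriple) (v : (G.delete t.H t.hereditary).V) :
    v ∈ t.pair.W ↔ (∃ e, (G.delete t.H t.hereditary).s e = v) ∧
      ∀ e, (G.delete t.H t.hereditary).s e = v →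
        tripleCon t (G.edge e.1 * G.ghost e.1) (G.vert v.1) := by
  constructor
  · intro hv
    obtain ⟨e, he⟩ := Set.encard_eq_one.1 (t.pair.subset_indexOne hv)
    refine ⟨⟨e, (he ▸ rfl : e ∈ {e | (G.delete t.H t.hereditary).s e = v})⟩, ?_⟩
    rintro e rfl
    exact ConGen.Rel.of _ _ (TripleRel.edge e hv)
  · rintro ⟨⟨e, rfl⟩, h⟩
    by_contra hW
    have h1 := tripleCon_le_twist_ker t (fun _ => (0 : ℤ)) (by simp) (h e rfl)
    rw [Representation.ker_iff, EndoRel.ext_iff] at h1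
    -- The empty word is not in the image of an edge whose source is outside `W`.
    have h2 := h1 (G.s e.1, [], 0) (G.s e.1, [], 0)
    rw [Representation.toRel_vert, Representation.toRel_edge_mul_ghost] at h2
    obtain ⟨-, -, y, hy⟩ := h2.2 ⟨rfl, rfl, ((G.delete t.H t.hereditary).s e).2⟩
    rw [twist_map_of_notMem t _ hW] at hy
    simp at hy

/-- The value of a cycle function as a natural number, with `0` for `∞`. -/
def periodNat : WithTop ℕ+ → ℕ
  | ⊤ => 0
  | (n : ℕ+) => n

/-- In a model where `c` translates by 1 modulo its period, a power of `c` acts as its base only if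
the period divides the exponent. For `f(c) = ∞` the modulus is 0, the group is ℤ, and the conclusion
reads `m = 0`. -/
theorem dvd_of_tripleCon_deletePow (t : G.CongruenceTriple)
    (c : (G.delete t.H t.hereditary).cyclesIn t.pair.W) (m : ℕ)
    (h : tripleCon t (deletePow c.1 m) (G.vert c.1.base.1)) :
    periodNat (t.pair.f c) ∣ m := by
  classical
  obtain ⟨e, l, hel⟩ := List.exists_cons_of_ne_nil c.1.ne_nil
  set δ : G.E → ZMod (periodNat (t.pair.f c)) := Pi.single e.1 1 with hδ
  have hle : tripleCon t ≤ (twist t δ).ker := by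
    refine tripleCon_le_twist_ker t δ fun d n hn => ?_
    -- A cycle through `e` is a rotation of `c`, so its value of `f` is the modulus; any other cycle
    -- has total translation 0.
    by_cases hed : e ∈ d.1.edges
    · have hcd := Cycle.isRotated t.pair.subset_indexOne c.2
        (show e ∈ c.1.edges by rw [hel]; simp) hed
      rw [← t.pair.f_rotated c d hcd] at hn
      have h0 : ((n : ℕ) : ZMod (periodNat (t.pair.f c))) = 0 := by
        rw [hn]; exact ZMod.natCast_self _
      rw [nsmul_eq_mul, h0, zero_mul]
    · rw [List.sum_eq_zero, smul_zero]
      intro x hx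
      obtain ⟨f, hf, rfl⟩ := List.mem_map.1 hx
      refine Pi.single_eq_of_ne (fun hfe => hed ?_) _
      rwa [← (Subtype.ext hfe : f = e)]
  have h1 := (twist_ker_deletePow t δ c.2 m).1 (hle h)
  -- A cycle passes through `e` only once, since its edges have distinct sources.
  have hsum : (c.1.edges.map fun e => δ e.1).sum = 1 := by
    have hn := c.1.nodup
    rw [hel, List.map_cons, List.nodup_cons] at hn
    rw [hel, List.map_cons, List.sum_cons, List.sum_eq_zero, add_zero]
    · exact Pi.single_eq_same _ _
    · intro x hx
      obtain ⟨f, hf, rfl⟩ := List.mem_map.1 hx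
      refine Pi.single_eq_of_ne (fun hfe => hn.1 ?_) _
      rw [← (Subtype.ext hfe : f = e)]
      exact List.mem_map_of_mem hf
  rw [hsum, nsmul_one] at h1
  exact (ZMod.natCast_eq_zero_iff _ _).1 h1

theorem f_eq_leastPos_tripleCon (t : G.CongruenceTriple)
    (c : (G.delete t.H t.hereditary).cyclesIn t.pair.W) :
    t.pair.f c =
      leastPos fun m : ℕ+ => tripleCon t (deletePow c.1 m) (G.vert c.1.base.1) := by
  symm
  cases hf : t.pair.f c with
  | top =>
    refine leastPos_eq_top_iff.2 fun m hm => ?_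
    have h := dvd_of_tripleCon_deletePow t c m hm
    rw [hf] at h
    exact m.ne_zero (Nat.eq_zero_of_zero_dvd h)
  | coe n =>
    refine leastPos_eq_coe_iff.2 ⟨ConGen.Rel.of _ _ (TripleRel.cycle c n hf), fun m hm => ?_⟩
    have h := dvd_of_tripleCon_deletePow t c m hm
    rw [hf] at h
    exact Nat.le_of_dvd m.pos h

/-- The type of the pair depends on `H`. Keeping `H` a variable lets the equation for the zero set
be substituted, so no transport is needed. -/
theorem conTriple_eq_mk (ρ : Con G.InvSemigroup) {H : Set G.V} (hH : G.IsHereditary H)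
    (p : (G.delete H hH).CongruencePair) (h : zeroSet ρ = H)
    (hW : ∀ v, v ∈ p.W ↔ (∃ e, (G.delete H hH).s e = v) ∧
      ∀ e, (G.delete H hH).s e = v → ρ (G.edge e.1 * G.ghost e.1) (G.vert v.1))
    (hf : ∀ c, p.f c = leastPos fun m : ℕ+ => ρ (deletePow c.1 m) (G.vert c.1.base.1)) :
    conTriple ρ = ⟨H, hH, p⟩ := by
  subst h
  obtain ⟨W, hW1, f, hf1⟩ := p
  obtain rfl : W = conW ρ := Set.ext hW
  obtain rfl : f = fun c => conF ρ c.1 := funext hf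
  rfl

theorem conTriple_tripleCon (t : G.CongruenceTriple) : conTriple (tripleCon t) = t :=
  conTriple_eq_mk _ t.hereditary t.pair (zeroSet_tripleCon t) (mem_W_iff_tripleCon t)
    (f_eq_leastPos_tripleCon t)

end DirectedGraph

theorem theorem1p2 (G : DirectedGraph.{u, v}) :
    Function.LeftInverse
        (DirectedGraph.tripleCon : G.CongruenceTriple → Con G.InvSemigroup)
        (DirectedGraph.conTriple : Con G.InvSemigroup → G.CongruenceTriple) ∧
      Function.RightInverse
        (DirectedGraph.tripleCon : G.CongruenceTriple → Con G.InvSemigroup)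
        (DirectedGraph.conTriple : Con G.InvSemigroup → G.CongruenceTriple) ∧
      Function.Bijective (DirectedGraph.conTriple : Con G.InvSemigroup → G.CongruenceTriple) :=
  ⟨DirectedGraph.tripleCon_conTriple, DirectedGraph.conTriple_tripleCon,
    Function.LeftInverse.injective DirectedGraph.tripleCon_conTriple,
    Function.RightInverse.surjective DirectedGraph.conTriple_tripleCon⟩
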